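/- Let $n$ items, ranked $1,\dots,n$ from best to worst, arrive at independent times uniformly distributed on $[0,1]$. Let $N_t$ be the number of arrivals up to time $t$. An arrival is called a record if it is better than all items that arrived before it, and its index is the value of $N_t$ at its arrival time $t$. Given cutoffs $a_1,a_2,\dots\in[0,1]$ (not depending on $n$), the cutoff strategy $\tau$ stops at the first time $t$ at which a record arrives and $t\ge a_{N_t}$; if there is no such time, then $\tau=1$. Let $W(\tau,n)$ be the probability that $\tau$ stops at the arrival of the best of the $n$ items. Suppose that $a_k\to x$ as $k\to\infty$ and, in case $0<x<1$, that $a_k>0$ for every $k\ge1$. Then $$W(\tau,n)\to -x\log x\qquad(n\to\infty),$$ where $0\log 0=0$. In particular, if $x=1/e$, the strategy $\tau$ is asymptotically optimal, that is, $W(\tau,n)\to 1/e$. -/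

import Mathlib

open Filter Topology MeasureTheory

noncomputable section

namespace BestChoice

/- There are `n` items, labelled by `Fin n` from best to worst: item `0` is the overall best.
Item `i` arrives at time `u i`, and the arrival times are i.i.d. uniform on `[0,1]`. -/

/-- The joint law of the arrival times of `n` items: i.i.d. uniform on `[0,1]`. -/
def arrivalLaw (n : ℕ) : Measure (Fin n → ℝ) :=
  Measure.pi fun _ => (volume : Measure ℝ).restrict (Set.Icc 0 1)

/-- The counting process `N_t`: the number of items that have arrived by time `t`. -/
def arrivalCount {n : ℕ} (u : Fin n → ℝ) (t : ℝ) : ℕ :=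
  (Finset.univ.filter fun j => u j ≤ t).card

/-- The relative rank of item `i` at its arrival: its rank (`1` is best) among the items that have
arrived by time `u i`, itself included. -/
def relRank {n : ℕ} (u : Fin n → ℝ) (i : Fin n) : ℕ :=
  (Finset.univ.filter fun j => u j ≤ u i ∧ j ≤ i).card

/-- Item `i` is a record: at its arrival it is the best so far. -/
def IsRecord {n : ℕ} (u : Fin n → ℝ) (i : Fin n) : Prop :=
  relRank u i = 1

instance {n : ℕ} (u : Fin n → ℝ) (i : Fin n) : Decidable (IsRecord u i) :=
  inferInstanceAs (Decidable (relRank u i = 1))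

/-- The player wins with the stopping time `τ` if `τ` is the arrival time of a record after which
there are no further records. -/
def Wins {n : ℕ} (τ : (Fin n → ℝ) → ℝ) (u : Fin n → ℝ) : Prop :=
  ∃ i, τ u = u i ∧ IsRecord u i ∧ ∀ j, u i < u j → ¬ IsRecord u j

/-- The winning probability `W(τ, n)`. The strategy is given by its stopping time, as a function
of the number of items and of the arrival times of the items. -/
def winProb (τ : (n : ℕ) → (Fin n → ℝ) → ℝ) (n : ℕ) : ℝ :=
  (arrivalLaw n).real {u | Wins (τ n) u}

/-- A strategy is asymptotically optimal if `W(τ, n) → 1/e`. -/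
def AsymptoticallyOptimal (τ : (n : ℕ) → (Fin n → ℝ) → ℝ) : Prop :=
  Tendsto (winProb τ) atTop (𝓝 (1 / Real.exp 1))

/-- The strategy with cutoffs `a 1, a 2, …`: stop at the first time `t` at which a record arrives
and `a (N_t) ≤ t`; the value is `1` if there is no such time. (`a 0` plays no role, as `N_t ≥ 1`
at an arrival time `t`.) -/
def cutoffStrategy (a : ℕ → ℝ) (n : ℕ) (u : Fin n → ℝ) : ℝ :=
  (((Finset.univ.filter fun i => IsRecord u i ∧ a (arrivalCount u (u i)) ≤ u i).image u).min).untopD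
    1

end BestChoice

end

namespace BestChoice

/-! ### Combinatorics of records -/

/-! With the constant cutoff x, the strategy wins iff the best item arrives at some t ≥ x and no
record arrives in [x, t). Given t, this means that nothing else arrives before t or that the best of
the earlier arrivals comes before x. The probability tends to x/t, and integrating over [x, 1] gives
-x log x (`tendsto_winProb_const`).

For 0 < x < 1, the cutoffs with k ≥ 1 stay above some m > 0, so nothing is accepted before m. By
time m many items have arrived with high probability, so all later cutoffs are within δ of x. The
choice can then differ from that of the constant cutoff only if a record arrives in [x - δ, x + δ),
which has probability of order δ (`cutoffStrategy_eq_const`). For x = 0 the strategy typically stops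
too early, for x = 1 too late; either way the limit is 0. -/

theorem isRecord_iff {n : ℕ} (u : Fin n → ℝ) (i : Fin n) :
    IsRecord u i ↔ ∀ j < i, u i < u j := by
  unfold IsRecord relRank
  have hi : i ∈ Finset.univ.filter fun j => u j ≤ u i ∧ j ≤ i := by simp
  rw [Finset.card_eq_one]
  constructor
  · rintro ⟨k, hk⟩ j hj
    by_contra! h
    have hj' : j ∈ Finset.univ.filter fun j => u j ≤ u i ∧ j ≤ i := by simp [h, hj.le]
    rw [hk, Finset.mem_singleton] at hi hj'
    exact hj.ne (hj'.trans hi.symm)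
  · intro h
    refine ⟨i, Finset.eq_singleton_iff_unique_mem.2 ⟨hi, fun j hj => ?_⟩⟩
    simp only [Finset.mem_filter, Finset.mem_univ, true_and] at hj
    by_contra hne
    exact absurd (h j (lt_of_le_of_ne hj.2 hne)) (not_lt.2 hj.1)

theorem isRecord_zero {n : ℕ} (u : Fin (n + 1) → ℝ) : IsRecord u 0 := by
  rw [isRecord_iff]
  intro j hj
  exact absurd hj (Fin.not_lt_zero j)

/-- `Fin.cons` puts a new best item in front, and nothing arriving after it can be a record. This
recursion drives the induction in `arrivalLaw_real_noRecord`. -/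
theorem isRecord_cons_succ_iff {n : ℕ} (t : ℝ) (v : Fin n → ℝ) (j : Fin n) :
    IsRecord (Fin.cons t v : Fin (n + 1) → ℝ) j.succ ↔ v j < t ∧ IsRecord v j := by
  simp only [isRecord_iff, Fin.forall_fin_succ, Fin.cons_succ, Fin.cons_zero, Fin.succ_lt_succ_iff,
    Fin.succ_pos, forall_true_left]

/-- Winning means stopping at the arrival of the best item. -/
theorem wins_iff {n : ℕ} (τ : (Fin (n + 1) → ℝ) → ℝ) (u : Fin (n + 1) → ℝ) :
    Wins τ u ↔ τ u = u 0 := by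
  constructor
  · rintro ⟨i, hτ, hi, hlast⟩
    rw [hτ]
    rcases eq_or_ne i 0 with rfl | hne
    · rfl
    · exact absurd (isRecord_zero u)
        (hlast 0 ((isRecord_iff u i).1 hi 0 (Fin.pos_iff_ne_zero.2 hne)))
  · intro h
    refine ⟨0, h, isRecord_zero u, fun j hj hrec => ?_⟩
    rcases eq_or_ne j 0 with rfl | hne
    · exact lt_irrefl _ hj
    · exact lt_asymm hj ((isRecord_iff u j).1 hrec 0 (Fin.pos_iff_ne_zero.2 hne))

/-- No record arrives during `[s, r)`. -/
def NoRecord {n : ℕ} (s r : ℝ) (u : Fin n → ℝ) : Prop :=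
  ∀ i, IsRecord u i → s ≤ u i → r ≤ u i

theorem noRecord_cons_iff {n : ℕ} (s r t : ℝ) (v : Fin n → ℝ) :
    NoRecord s r (Fin.cons t v : Fin (n + 1) → ℝ) ↔
      (s ≤ t → r ≤ t) ∧ ∀ j, v j < t → IsRecord v j → s ≤ v j → r ≤ v j := by
  simp only [NoRecord, Fin.forall_fin_succ, isRecord_cons_succ_iff, Fin.cons_zero, Fin.cons_succ,
    isRecord_zero, forall_true_left, and_imp]

theorem noRecord_cons_of_lt {n : ℕ} {s r t : ℝ} (h : t < s) (v : Fin n → ℝ) :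
    NoRecord s r (Fin.cons t v : Fin (n + 1) → ℝ) :=
  (noRecord_cons_iff s r t v).2
    ⟨fun h' => absurd h (not_lt.2 h'), fun _ hj _ hs => absurd (hs.trans_lt hj) (not_lt.2 h.le)⟩

theorem noRecord_cons_of_le {n : ℕ} {s r t : ℝ} (h : r ≤ t) (v : Fin n → ℝ) :
    NoRecord s r (Fin.cons t v : Fin (n + 1) → ℝ) ↔ NoRecord s r v := by
  rw [noRecord_cons_iff]
  refine ⟨fun H i hi hs => ?_, fun H => ⟨fun _ => h, fun j _ => H j⟩⟩
  rcases lt_or_ge (v i) t with hlt | hge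
  · exact H.2 i hlt hi hs
  · exact h.trans hge

theorem measurableSet_noRecord (n : ℕ) (s r : ℝ) :
    MeasurableSet {u : Fin n → ℝ | NoRecord s r u} := by
  simp only [NoRecord, isRecord_iff]
  measurability

/-! ### The law of the arrival times -/

instance (n : ℕ) : IsProbabilityMeasure (arrivalLaw n) := by
  have : IsProbabilityMeasure ((volume : Measure ℝ).restrict (Set.Icc 0 1)) := ⟨by simp⟩
  unfold arrivalLaw
  infer_instance

/-- Conditioning on the arrival time of the best item. -/
theorem arrivalLaw_real_succ {n : ℕ} {S : Set (Fin (n + 1) → ℝ)} (hS : MeasurableSet S) :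
    (arrivalLaw (n + 1)).real S =
      ∫ t in Set.Icc (0 : ℝ) 1, (arrivalLaw n).real {v | (Fin.cons t v : Fin (n + 1) → ℝ) ∈ S} := by
  have hmp := (measurePreserving_piFinSuccAbove
    (fun _ : Fin (n + 1) => (volume : Measure ℝ).restrict (Set.Icc 0 1)) 0).symm
  have h1 : arrivalLaw (n + 1) S = (((volume : Measure ℝ).restrict (Set.Icc 0 1)).prod
      (arrivalLaw n)) ((fun p : ℝ × (Fin n → ℝ) => (Fin.cons p.1 p.2 : Fin (n + 1) → ℝ)) ⁻¹' S) := by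
    have := hmp.measure_preimage hS.nullMeasurableSet
    rw [arrivalLaw, ← this]
    congr 1
    ext p
    simp [MeasurableEquiv.piFinSuccAbove]
    rfl
  have hcons : Measurable fun p : ℝ × (Fin n → ℝ) => (Fin.cons p.1 p.2 : Fin (n + 1) → ℝ) := by
    refine measurable_pi_iff.2 (Fin.forall_fin_succ.2 ⟨?_, fun j => ?_⟩)
    · simpa using measurable_fst
    · simpa using! (measurable_pi_apply j).comp measurable_snd
  rw [measureReal_def, h1, Measure.prod_apply (hcons hS)]
  simp only [measureReal_def]
  exact (integral_toReal (measurable_measure_prodMk_left (hcons hS)).aemeasurable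
    (ae_of_all _ fun _ => measure_lt_top _ _)).symm

theorem arrivalLaw_real_lt {n : ℕ} {c : ℝ} (h0 : 0 ≤ c) (h1 : c ≤ 1) :
    (arrivalLaw (n + 1)).real {u | u 0 < c} = c := by
  rw [arrivalLaw_real_succ (by measurability)]
  have : ∀ t : ℝ, (arrivalLaw n).real
      {v | (Fin.cons t v : Fin (n + 1) → ℝ) ∈ {u : Fin (n + 1) → ℝ | u 0 < c}} =
      (Set.Iio c).indicator (fun _ => 1) t := by
    intro t
    by_cases h : t < c <;> simp [h]
  simp only [this]
  rw [setIntegral_indicator measurableSet_Iio, setIntegral_const, measureReal_def,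
    show Set.Icc (0 : ℝ) 1 ∩ Set.Iio c = Set.Ico 0 c by
      ext t; simp only [Set.mem_inter_iff, Set.mem_Icc, Set.mem_Iio, Set.mem_Ico]; grind]
  simp [h0]

theorem arrivalLaw_real_ge {n : ℕ} {c : ℝ} (h0 : 0 ≤ c) (h1 : c ≤ 1) :
    (arrivalLaw (n + 1)).real {u | c ≤ u 0} = 1 - c := by
  have h := probReal_compl_eq_one_sub (μ := arrivalLaw (n + 1))
    (s := {u | u 0 < c}) (by measurability)
  rw [arrivalLaw_real_lt h0 h1] at h
  rw [← h]
  congr 1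
  ext u
  simp

/-- Condition on the best item: arriving before s it excludes later records, in [s, r) it is itself
a forbidden record, and from r on it is irrelevant. Hence p (n + 1) = s + (1 - r) * p n with p 0 =
1, whose fixed point is s / r. -/
theorem arrivalLaw_real_noRecord (n : ℕ) {s r : ℝ} (hs : 0 ≤ s) (hsr : s ≤ r) (hr0 : 0 < r)
    (hr : r ≤ 1) :
    (arrivalLaw n).real {u | NoRecord s r u} = s / r + (1 - s / r) * (1 - r) ^ n := by
  induction n with
  | zero =>
    have : {u : Fin 0 → ℝ | NoRecord s r u} = Set.univ :=
      Set.eq_univ_of_forall fun u i => i.elim0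
    simp [this]
  | succ n ih =>
    rw [arrivalLaw_real_succ (measurableSet_noRecord _ _ _)]
    set p := (arrivalLaw n).real {u | NoRecord s r u}
    have : ∀ t : ℝ, (arrivalLaw n).real
        {v | (Fin.cons t v : Fin (n + 1) → ℝ) ∈ {u : Fin (n + 1) → ℝ | NoRecord s r u}} =
        (Set.Iio s).indicator (fun _ => 1) t + (Set.Ici r).indicator (fun _ => p) t := by
      intro t
      simp only [Set.mem_ofPred_eq]
      rcases lt_or_ge t s with h | h
      · simp [noRecord_cons_of_lt h, h, h.trans_le hsr]
      · rcases lt_or_ge t r with h' | h'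
        · have : ∀ v : Fin n → ℝ, ¬ NoRecord s r (Fin.cons t v : Fin (n + 1) → ℝ) := fun v hv =>
            absurd (((noRecord_cons_iff s r t v).1 hv).1 h) (not_le.2 h')
          simp [this, h, h']
        · simp [noRecord_cons_of_le h', h, h', p]
    simp only [this]
    rw [integral_add ((integrable_const _).indicator measurableSet_Iio)
        ((integrable_const _).indicator measurableSet_Ici),
      setIntegral_indicator measurableSet_Iio, setIntegral_indicator measurableSet_Ici,
      setIntegral_const, setIntegral_const, measureReal_def, measureReal_def,
      show Set.Icc (0 : ℝ) 1 ∩ Set.Iio s = Set.Ico 0 s by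
        ext t; simp only [Set.mem_inter_iff, Set.mem_Icc, Set.mem_Iio, Set.mem_Ico]; grind,
      show Set.Icc (0 : ℝ) 1 ∩ Set.Ici r = Set.Icc r 1 by
        ext t; simp only [Set.mem_inter_iff, Set.mem_Icc, Set.mem_Ici]; grind]
    rw [Real.volume_Ico, Real.volume_Icc, ENNReal.toReal_ofReal (by linarith),
      ENNReal.toReal_ofReal (by linarith), ih]
    simp only [smul_eq_mul]
    field_simp
    ring

/-- A Chernoff bound for the number of arrivals. -/
theorem arrivalLaw_real_arrivalCount_lt_le (n K : ℕ) {c : ℝ} (h0 : 0 ≤ c) (h1 : c ≤ 1) :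
    (arrivalLaw n).real {u | arrivalCount u c < K} ≤ 2 ^ K * (1 - c / 2) ^ n := by
  -- Each arrival up to time c contributes a factor 1/2, so the product is (1/2)^N_c, and Markov's
  -- inequality applies at level (1/2)^K.
  let g : ℝ → ℝ := fun t => 1 - (Set.Iic c).indicator (fun _ => 1 / 2) t
  have hgI : Integrable g ((volume : Measure ℝ).restrict (Set.Icc 0 1)) :=
    (integrable_const _).sub ((integrable_const _).indicator measurableSet_Iic)
  have hg : ∫ t in Set.Icc (0 : ℝ) 1, g t = 1 - c / 2 := by
    rw [integral_sub (integrable_const _) ((integrable_const _).indicator measurableSet_Iic),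
      setIntegral_indicator measurableSet_Iic, setIntegral_const, setIntegral_const,
      measureReal_def, measureReal_def,
      show Set.Icc (0 : ℝ) 1 ∩ Set.Iic c = Set.Icc 0 c by
        ext t; simp only [Set.mem_inter_iff, Set.mem_Icc, Set.mem_Iic]; grind]
    simp [h0]
    ring
  have hprod : ∀ u : Fin n → ℝ, ∏ i, g (u i) = (1 / 2) ^ arrivalCount u c := by
    intro u
    have : ∀ i, g (u i) = if u i ≤ c then 1 / 2 else 1 := by
      intro i
      by_cases h : u i ≤ c
      · simp [g, h]; norm_num
      · simp [g, h]
    simp only [this]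
    rw [Finset.prod_ite, Finset.prod_const, Finset.prod_const_one, mul_one]
    rfl
  have hint : ∫ u, ∏ i, g (u i) ∂(arrivalLaw n) = (1 - c / 2) ^ n := by
    rw [arrivalLaw, integral_fintype_prod_eq_pow, hg, Fintype.card_fin]
  have hI : Integrable (fun u : Fin n → ℝ => ∏ i, g (u i)) (arrivalLaw n) :=
    Integrable.fintype_prod fun _ => hgI
  have hmarkov := mul_meas_ge_le_integral_of_nonneg (μ := arrivalLaw n)
    (f := fun u : Fin n → ℝ => ∏ i, g (u i))
    (ae_of_all _ fun u => by simp only [hprod]; positivity) hI ((1 / 2) ^ K)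
  rw [hint] at hmarkov
  have hsub : (arrivalLaw n).real {u | arrivalCount u c < K} ≤
      (arrivalLaw n).real {u : Fin n → ℝ | (1 / 2) ^ K ≤ ∏ i, g (u i)} := by
    refine measureReal_mono fun u hu => ?_
    simp only [Set.mem_ofPred_eq, hprod] at hu ⊢
    exact pow_le_pow_of_le_one (by norm_num) (by norm_num) hu.le
  calc _ ≤ _ := hsub
    _ = 2 ^ K * ((1 / 2) ^ K *
        (arrivalLaw n).real {u : Fin n → ℝ | (1 / 2) ^ K ≤ ∏ i, g (u i)}) := by
      rw [← mul_assoc, ← mul_pow]; norm_num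
    _ ≤ _ := by gcongr

theorem tendsto_arrivalLaw_real_arrivalCount_lt (K : ℕ) {c : ℝ} (h0 : 0 < c) (h1 : c ≤ 1) :
    Tendsto (fun n => (arrivalLaw n).real {u | arrivalCount u c < K}) atTop (𝓝 0) := by
  refine squeeze_zero (fun _ => measureReal_nonneg)
    (fun n => arrivalLaw_real_arrivalCount_lt_le n K h0.le h1) ?_
  simpa using (tendsto_pow_atTop_nhds_zero_of_lt_one (by linarith : (0 : ℝ) ≤ 1 - c / 2)
    (by linarith)).const_mul ((2 : ℝ) ^ K)

theorem arrivalCount_mono {n : ℕ} (u : Fin n → ℝ) : Monotone (arrivalCount u) :=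
  fun _ _ h => Finset.card_le_card <|
    Finset.monotone_filter_right _ fun _ _ h' => le_trans h' h

/-! ### Cutoff strategies -/

theorem cutoffStrategy_le {a : ℕ → ℝ} {n : ℕ} {u : Fin n → ℝ} {i : Fin n} (hi : IsRecord u i)
    (ha : a (arrivalCount u (u i)) ≤ u i) : cutoffStrategy a n u ≤ u i := by
  unfold cutoffStrategy
  have hmem : u i ∈ (Finset.univ.filter fun i =>
      IsRecord u i ∧ a (arrivalCount u (u i)) ≤ u i).image u :=
    Finset.mem_image_of_mem u (by simp [hi, ha])
  obtain ⟨b, hb⟩ := Finset.min_of_mem hmem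
  rw [hb]
  exact Finset.min_le_of_eq hmem hb

theorem cutoffStrategy_eq_or (a : ℕ → ℝ) (n : ℕ) (u : Fin n → ℝ) :
    (∃ i, IsRecord u i ∧ a (arrivalCount u (u i)) ≤ u i ∧ cutoffStrategy a n u = u i) ∨
      (∀ i, IsRecord u i → u i < a (arrivalCount u (u i))) ∧ cutoffStrategy a n u = 1 := by
  unfold cutoffStrategy
  rcases Finset.eq_empty_or_nonempty ((Finset.univ.filter fun i =>
      IsRecord u i ∧ a (arrivalCount u (u i)) ≤ u i).image u) with h | h
  · right
    refine ⟨fun i hi => ?_, by rw [h]; rfl⟩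
    rw [Finset.image_eq_empty, Finset.filter_eq_empty_iff] at h
    exact lt_of_not_ge fun hai => h (Finset.mem_univ i) ⟨hi, hai⟩
  · left
    obtain ⟨b, hb⟩ := Finset.min_of_nonempty h
    obtain ⟨i, hi, rfl⟩ := Finset.mem_image.1 (Finset.mem_of_min hb)
    simp only [Finset.mem_filter, Finset.mem_univ, true_and] at hi
    exact ⟨i, hi.1, hi.2, by rw [hb]; rfl⟩

theorem cutoffStrategy_congr {a b : ℕ → ℝ} {n : ℕ} {u : Fin n → ℝ}
    (h : ∀ i, IsRecord u i →
      (a (arrivalCount u (u i)) ≤ u i ↔ b (arrivalCount u (u i)) ≤ u i)) :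
    cutoffStrategy a n u = cutoffStrategy b n u := by
  unfold cutoffStrategy
  rw [Finset.filter_congr fun i _ => and_congr_right fun hi => h i hi]

/-! ### Constant cutoffs -/

theorem wins_const_iff {n : ℕ} {x : ℝ} (hx : x ≤ 1) (u : Fin (n + 1) → ℝ) :
    Wins (cutoffStrategy (fun _ => x) (n + 1)) u ↔ x ≤ u 0 ∧ NoRecord x (u 0) u := by
  rw [wins_iff]
  constructor
  · intro h
    refine ⟨?_, fun i hi hxi => h ▸ cutoffStrategy_le hi hxi⟩
    rw [← h]
    rcases cutoffStrategy_eq_or (fun _ => x) (n + 1) u with ⟨i, -, hi, h'⟩ | ⟨-, h'⟩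
    · rwa [h']
    -- The default value 1 also satisfies the bound, as x ≤ 1.
    · rwa [h']
  · rintro ⟨h0, h⟩
    refine le_antisymm (cutoffStrategy_le (isRecord_zero u) h0) ?_
    rcases cutoffStrategy_eq_or (fun _ => x) (n + 1) u with ⟨i, hi, hxi, h'⟩ | ⟨h', -⟩
    · rw [h']
      exact h i hi hxi
    · exact absurd h0 (not_le.2 (h' 0 (isRecord_zero u)))

/-- The winning probability with the constant cutoff `x`. -/
theorem winProb_const {x : ℝ} (hx0 : 0 < x) (hx1 : x ≤ 1) (n : ℕ) :
    winProb (cutoffStrategy fun _ => x) (n + 1) =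
      ∫ t in Set.Icc x 1, (x / t + (1 - x / t) * (1 - t) ^ n) := by
  have hset : {u | Wins (cutoffStrategy (fun _ => x) (n + 1)) u} =
      {u : Fin (n + 1) → ℝ | x ≤ u 0 ∧ NoRecord x (u 0) u} := by
    ext u
    exact wins_const_iff hx1 u
  have hmeas : MeasurableSet {u : Fin (n + 1) → ℝ | x ≤ u 0 ∧ NoRecord x (u 0) u} := by
    simp only [NoRecord, isRecord_iff]
    measurability
  rw [winProb, hset, arrivalLaw_real_succ hmeas]
  -- A best item arriving at t is outside [x, t), so the event only concerns the other n items.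
  have : ∀ t ∈ Set.Icc (0 : ℝ) 1, (arrivalLaw n).real {v | (Fin.cons t v : Fin (n + 1) → ℝ) ∈
      {u : Fin (n + 1) → ℝ | x ≤ u 0 ∧ NoRecord x (u 0) u}} =
      (Set.Ici x).indicator (fun t => x / t + (1 - x / t) * (1 - t) ^ n) t := by
    intro t ht
    by_cases h : x ≤ t
    · simp [h, noRecord_cons_of_le,
        arrivalLaw_real_noRecord n hx0.le h (hx0.trans_le h) ht.2]
    · simp [h]
  rw [setIntegral_congr_fun measurableSet_Icc this, setIntegral_indicator measurableSet_Ici,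
    show Set.Icc (0 : ℝ) 1 ∩ Set.Ici x = Set.Icc x 1 by
      ext t; simp only [Set.mem_inter_iff, Set.mem_Icc, Set.mem_Ici]; grind]

theorem tendsto_winProb_const {x : ℝ} (hx0 : 0 < x) (hx1 : x ≤ 1) :
    Tendsto (winProb (cutoffStrategy fun _ => x)) atTop (𝓝 (-x * Real.log x)) := by
  rw [← tendsto_add_atTop_iff_nat 1]
  simp only [winProb_const hx0 hx1]
  have hlim : -x * Real.log x = ∫ t in Set.Icc x 1, x / t := by
    rw [integral_Icc_eq_integral_Ioc, ← intervalIntegral.integral_of_le hx1]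
    simp only [div_eq_mul_inv]
    rw [intervalIntegral.integral_const_mul, integral_inv_of_pos hx0 one_pos]
    simp
  rw [hlim]
  refine tendsto_integral_of_dominated_convergence (fun _ => 2) (fun n => ?_)
    (integrable_const _) (fun n => ?_) ?_
  · exact Measurable.aestronglyMeasurable (by fun_prop)
  · refine (ae_restrict_iff' measurableSet_Icc).2 (ae_of_all _ fun t ht => ?_)
    have ht0 : 0 < t := hx0.trans_le ht.1
    have h1 : 0 ≤ x / t := by positivity
    have h2 : x / t ≤ 1 := (div_le_one ht0).2 ht.1
    have h3 : 0 ≤ (1 - t) ^ n := pow_nonneg (by linarith [ht.2]) n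
    have h4 : (1 - t) ^ n ≤ 1 := pow_le_one₀ (by linarith [ht.2]) (by linarith)
    rw [Real.norm_eq_abs, abs_le]
    constructor <;> nlinarith
  · refine (ae_restrict_iff' measurableSet_Icc).2 (ae_of_all _ fun t ht => ?_)
    have ht0 : 0 < t := hx0.trans_le ht.1
    simpa using ((tendsto_pow_atTop_nhds_zero_of_lt_one (by linarith [ht.2] : (0 : ℝ) ≤ 1 - t)
      (by linarith)).const_mul (1 - x / t)).const_add (x / t)

/-! ### Convergent cutoffs -/

theorem tendsto_arrivalLaw_real_noRecord {s r : ℝ} (hs : 0 ≤ s) (hsr : s ≤ r) (hr0 : 0 < r)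
    (hr : r ≤ 1) :
    Tendsto (fun n => (arrivalLaw n).real {u | NoRecord s r u}) atTop (𝓝 (s / r)) := by
  simp only [arrivalLaw_real_noRecord _ hs hsr hr0 hr]
  simpa using ((tendsto_pow_atTop_nhds_zero_of_lt_one (by linarith : (0 : ℝ) ≤ 1 - r)
      (by linarith)).const_mul (1 - s / r)).const_add (s / r)

theorem winProb_nonneg (τ : (n : ℕ) → (Fin n → ℝ) → ℝ) (n : ℕ) : 0 ≤ winProb τ n :=
  measureReal_nonneg

/-- Once many items have arrived by time ε², any record in [ε², ε) is accepted unless the strategy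
has stopped before. A win then forces the best item to arrive before ε. -/
theorem tendsto_winProb_of_tendsto_zero {a : ℕ → ℝ} (ha : Tendsto a atTop (𝓝 0)) :
    Tendsto (winProb (cutoffStrategy a)) atTop (𝓝 0) := by
  rw [← tendsto_add_atTop_iff_nat 1]
  refine Metric.tendsto_atTop.2 fun η hη => ?_
  -- One ε bounds the chance that the best item comes before ε; the other is the limit ε²/ε for no
  -- record in [ε², ε).
  obtain ⟨ε, hε0, hε1, hεη⟩ : ∃ ε : ℝ, 0 < ε ∧ ε ≤ 1 ∧ ε + ε < η :=
    ⟨min 1 (η / 3), by positivity, min_le_left _ _, by linarith [min_le_right 1 (η / 3)]⟩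
  have hδ0 : 0 < ε * ε := by positivity
  have hδε : ε * ε ≤ ε := mul_le_of_le_one_left hε0.le hε1
  obtain ⟨K, hK⟩ := eventually_atTop.1 (ha.eventually_lt_const hδ0)
  have hlim := ((tendsto_arrivalLaw_real_noRecord hδ0.le hδε hε0 hε1).add
    (tendsto_arrivalLaw_real_arrivalCount_lt K hδ0 (hδε.trans hε1))).const_add ε
  rw [mul_div_cancel_right₀ ε hε0.ne', add_zero] at hlim
  obtain ⟨N, hN⟩ := eventually_atTop.1 (hlim.eventually_lt_const hεη)
  refine ⟨N, fun n hn => ?_⟩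
  rw [Real.dist_eq, sub_zero, abs_of_nonneg (winProb_nonneg _ _)]
  refine lt_of_le_of_lt ?_ (hN (n + 1) (by lia))
  have hsub : {u | Wins (cutoffStrategy a (n + 1)) u} ⊆ {u | u 0 < ε} ∪
      ({u | NoRecord (ε * ε) ε u} ∪ {u | arrivalCount u (ε * ε) < K}) := by
    intro u hu
    by_contra hcon
    simp only [Set.mem_union, Set.mem_ofPred_eq, not_or, not_lt, NoRecord, not_forall, not_le] at hcon
    obtain ⟨h0, ⟨i, hi, hδi, hiε⟩, hcount⟩ := hcon
    have hτ := (wins_iff _ u).1 hu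
    have := cutoffStrategy_le (a := a) hi
      ((hK _ (hcount.trans (arrivalCount_mono u hδi))).le.trans hδi)
    linarith
  calc winProb (cutoffStrategy a) (n + 1) ≤ _ := measureReal_mono hsub
    _ ≤ _ := measureReal_union_le _ _
    _ ≤ _ := add_le_add (arrivalLaw_real_lt hε0.le hε1).le (measureReal_union_le _ _)

/-- Once many items have arrived by time ε, nothing is accepted in [ε, 1 - ε), where the best item
most likely arrives. -/
theorem tendsto_winProb_of_tendsto_one {a : ℕ → ℝ} (ha : Tendsto a atTop (𝓝 1)) :
    Tendsto (winProb (cutoffStrategy a)) atTop (𝓝 0) := by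
  rw [← tendsto_add_atTop_iff_nat 1]
  refine Metric.tendsto_atTop.2 fun η hη => ?_
  obtain ⟨ε, hε0, hε1, hεη⟩ : ∃ ε : ℝ, 0 < ε ∧ ε ≤ 1 ∧ ε + ε < η :=
    ⟨min 1 (η / 3), by positivity, min_le_left _ _, by linarith [min_le_right 1 (η / 3)]⟩
  obtain ⟨K, hK⟩ := eventually_atTop.1 (ha.eventually_const_lt (show 1 - ε < 1 by linarith))
  have hlim := (tendsto_arrivalLaw_real_arrivalCount_lt K hε0 hε1).const_add (ε + ε)
  rw [add_zero] at hlim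
  obtain ⟨N, hN⟩ := eventually_atTop.1 (hlim.eventually_lt_const hεη)
  refine ⟨N, fun n hn => ?_⟩
  rw [Real.dist_eq, sub_zero, abs_of_nonneg (winProb_nonneg _ _)]
  refine lt_of_le_of_lt ?_ (hN (n + 1) (by lia))
  have hsub : {u | Wins (cutoffStrategy a (n + 1)) u} ⊆ ({u | u 0 < ε} ∪ {u | 1 - ε ≤ u 0}) ∪
      {u | arrivalCount u ε < K} := by
    intro u hu
    by_contra hcon
    simp only [Set.mem_union, Set.mem_ofPred_eq, not_or, not_lt, not_le] at hcon
    obtain ⟨⟨h0, h1⟩, hcount⟩ := hcon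
    have hτ := (wins_iff _ u).1 hu
    rcases cutoffStrategy_eq_or a (n + 1) u with ⟨i, -, hai, h'⟩ | ⟨-, h'⟩
    · have hi : u i = u 0 := h'.symm.trans hτ
      rw [hi] at hai
      have := hK _ (hcount.trans (arrivalCount_mono u h0))
      linarith
    · linarith
  calc winProb (cutoffStrategy a) (n + 1) ≤ _ := measureReal_mono hsub
    _ ≤ _ := measureReal_union_le _ _
    _ ≤ _ := by
      gcongr
      refine (measureReal_union_le _ _).trans (add_le_add (arrivalLaw_real_lt hε0.le hε1).le ?_)
      rw [arrivalLaw_real_ge (by linarith) (by linarith)]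
      linarith

/-- Outside an event of small probability, the strategy makes the same choice as the one with the
constant cutoff `x`. -/
theorem cutoffStrategy_eq_const {a : ℕ → ℝ} {n K : ℕ} {m s r x : ℝ} {u : Fin n → ℝ}
    (hm : ∀ k, 1 ≤ k → m < a k) (hK : ∀ k, K ≤ k → s ≤ a k ∧ a k ≤ r) (hsx : s ≤ x) (hxr : x ≤ r)
    (hms : m ≤ s) (hcount : K ≤ arrivalCount u m) (hrec : NoRecord s r u) :
    cutoffStrategy a n u = cutoffStrategy (fun _ => x) n u := by
  refine cutoffStrategy_congr fun i hi => ?_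
  -- Before s both strategies refuse: up to m because every cutoff of index ≥ 1 exceeds m, after m
  -- because at least K items are present. From s on, the record comes at or after r and both
  -- accept.
  rcases lt_or_ge (u i) s with h | h
  · refine iff_of_false (not_le.2 ?_) (not_le.2 (h.trans_le hsx))
    rcases le_or_gt (u i) m with him | him
    · exact him.trans_lt (hm _ (Finset.card_pos.2 ⟨i, by simp⟩))
    · exact h.trans_le (hK _ (hcount.trans (arrivalCount_mono u him.le))).1
  · have hri := hrec i hi h
    exact iff_of_true ((hK _ (hcount.trans (arrivalCount_mono u (hms.trans h)))).2.trans hri)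
      (hxr.trans hri)

/-- This is where positivity of the cutoffs enters: a uniform lower bound rules out acceptance while
few items have arrived. -/
theorem exists_pos_forall_lt {a : ℕ → ℝ} {x : ℝ} (hx0 : 0 < x) (ha : Tendsto a atTop (𝓝 x))
    (hpos : ∀ k, 1 ≤ k → 0 < a k) : ∃ m, 0 < m ∧ ∀ k, 1 ≤ k → m < a k := by
  obtain ⟨K, hK⟩ := eventually_atTop.1 (ha.eventually_const_lt (half_lt_self hx0))
  have hfin : ∀ K : ℕ, ∃ m, 0 < m ∧ ∀ k, 1 ≤ k → k < K → m < a k := by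
    intro K
    induction K with
    | zero => exact ⟨1, one_pos, fun k _ hk => absurd hk (Nat.not_lt_zero k)⟩
    | succ K ih =>
      obtain ⟨m, hm0, hm⟩ := ih
      rcases Nat.eq_zero_or_pos K with rfl | hKpos
      · exact ⟨1, one_pos, fun k h1 hk => by lia⟩
      · refine ⟨min m (a K / 2), lt_min hm0 (half_pos (hpos K hKpos)), fun k h1 hk => ?_⟩
        rcases Nat.lt_succ_iff_lt_or_eq.1 hk with h | rfl
        · exact (min_le_left _ _).trans_lt (hm k h1 h)
        · exact (min_le_right _ _).trans_lt (half_lt_self (hpos k h1))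
  obtain ⟨m, hm0, hm⟩ := hfin K
  refine ⟨min m (x / 2), lt_min hm0 (half_pos hx0), fun k h1 => ?_⟩
  rcases lt_or_ge k K with h | h
  · exact (min_le_left _ _).trans_lt (hm k h1 h)
  · exact (min_le_right _ _).trans_lt (hK k h)

theorem tendsto_winProb_of_mem_Ioo {a : ℕ → ℝ} {x : ℝ} (hx0 : 0 < x) (hx1 : x < 1)
    (ha : Tendsto a atTop (𝓝 x)) (hpos : ∀ k, 1 ≤ k → 0 < a k) :
    Tendsto (winProb (cutoffStrategy a)) atTop (𝓝 (-x * Real.log x)) := by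
  suffices h : Tendsto (fun n => winProb (cutoffStrategy a) n -
      winProb (cutoffStrategy fun _ => x) n) atTop (𝓝 0) by
    simpa using h.add (tendsto_winProb_const hx0 hx1.le)
  obtain ⟨m₀, hm₀, hm⟩ := exists_pos_forall_lt hx0 ha hpos
  refine Metric.tendsto_atTop.2 fun η hη => ?_
  -- A record arrives in [x - δ, x + δ) with limiting probability 2δ/(x + δ), which is below 2δ/x.
  obtain ⟨δ, hδ0, hδx, hδ1, hδη⟩ : ∃ δ : ℝ, 0 < δ ∧ δ < x ∧ δ < 1 - x ∧ 2 * δ / x < η := by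
    refine ⟨min (min (x / 2) ((1 - x) / 2)) (η * x / 3), ?_, ?_, ?_, ?_⟩
    · have : 0 < 1 - x := by linarith
      positivity
    · linarith [min_le_left (min (x / 2) ((1 - x) / 2)) (η * x / 3),
        min_le_left (x / 2) ((1 - x) / 2)]
    · linarith [min_le_left (min (x / 2) ((1 - x) / 2)) (η * x / 3),
        min_le_right (x / 2) ((1 - x) / 2)]
    · rw [div_lt_iff₀ hx0]
      have : 0 < η * x := by positivity
      linarith [min_le_right (min (x / 2) ((1 - x) / 2)) (η * x / 3)]
  obtain ⟨K, hK⟩ := eventually_atTop.1 ((ha.eventually_const_le (show x - δ < x by linarith)).and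
    (ha.eventually_le_const (show x < x + δ by linarith)))
  obtain ⟨m, hm0, hmm, hmx⟩ : ∃ m, 0 < m ∧ m ≤ m₀ ∧ m ≤ x - δ :=
    ⟨min m₀ (x - δ), lt_min hm₀ (by linarith), min_le_left _ _, min_le_right _ _⟩
  have hlim := ((tendsto_arrivalLaw_real_noRecord (s := x - δ) (r := x + δ) (by linarith)
    (by linarith) (by linarith) (by linarith)).const_sub 1).add
    (tendsto_arrivalLaw_real_arrivalCount_lt K hm0 (by linarith))
  have hlt : 1 - (x - δ) / (x + δ) + 0 < η := by
    have h1 : 1 - (x - δ) / (x + δ) + 0 = 2 * δ / (x + δ) := by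
      field_simp
      ring
    rw [h1]
    refine lt_of_le_of_lt ?_ hδη
    gcongr
    linarith
  obtain ⟨N, hN⟩ := eventually_atTop.1 (hlim.eventually_lt_const hlt)
  refine ⟨N, fun n hn => ?_⟩
  rw [Real.dist_eq, sub_zero]
  refine lt_of_le_of_lt ?_ (hN n hn)
  set B : Set (Fin n → ℝ) := {u | NoRecord (x - δ) (x + δ) u}ᶜ ∪ {u | arrivalCount u m < K}
  have hB : (arrivalLaw n).real B ≤ 1 - (arrivalLaw n).real {u | NoRecord (x - δ) (x + δ) u} +
      (arrivalLaw n).real {u | arrivalCount u m < K} := by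
    rw [← probReal_compl_eq_one_sub (measurableSet_noRecord n _ _)]
    exact measureReal_union_le _ _
  have heq : ∀ u, u ∉ B → (Wins (cutoffStrategy a n) u ↔
      Wins (cutoffStrategy (fun _ => x) n) u) := by
    intro u hu
    simp only [B, Set.mem_union, Set.mem_compl_iff, Set.mem_ofPred_eq, not_or, not_not, not_lt] at hu
    simp only [Wins, cutoffStrategy_eq_const (fun k hk => hmm.trans_lt (hm k hk)) hK
      (by linarith : x - δ ≤ x) (by linarith) hmx hu.2 hu.1]
  have h1 : winProb (cutoffStrategy a) n ≤
      winProb (cutoffStrategy fun _ => x) n + (arrivalLaw n).real B :=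
    (measureReal_mono fun u hu => or_iff_not_imp_right.2 fun h => (heq u h).1 hu).trans
      (measureReal_union_le _ _)
  have h2 : winProb (cutoffStrategy fun _ => x) n ≤
      winProb (cutoffStrategy a) n + (arrivalLaw n).real B :=
    (measureReal_mono fun u hu => or_iff_not_imp_right.2 fun h => (heq u h).2 hu).trans
      (measureReal_union_le _ _)
  rw [abs_le]
  constructor <;> linarith

end BestChoice

theorem proposition4 (a : ℕ → ℝ) (ha : ∀ k, 1 ≤ k → a k ∈ Set.Icc (0 : ℝ) 1)
    (x : ℝ) (hx : Tendsto a atTop (𝓝 x))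
    (hpos : 0 < x → x < 1 → ∀ k, 1 ≤ k → 0 < a k) :
    Tendsto (BestChoice.winProb (BestChoice.cutoffStrategy a)) atTop (𝓝 (-x * Real.log x)) ∧
      (x = 1 / Real.exp 1 →
        BestChoice.AsymptoticallyOptimal (BestChoice.cutoffStrategy a)) := by
  have hxI : x ∈ Set.Icc (0 : ℝ) 1 :=
    isClosed_Icc.mem_of_tendsto hx (eventually_atTop.2 ⟨1, ha⟩)
  have key : Tendsto (BestChoice.winProb (BestChoice.cutoffStrategy a)) atTop
      (𝓝 (-x * Real.log x)) := by
    rcases hxI.1.eq_or_lt with rfl | h0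
    · simpa using BestChoice.tendsto_winProb_of_tendsto_zero hx
    · rcases hxI.2.eq_or_lt with rfl | h1
      · simpa using BestChoice.tendsto_winProb_of_tendsto_one hx
      · exact BestChoice.tendsto_winProb_of_mem_Ioo h0 h1 hx (hpos h0 h1)
  refine ⟨key, fun h => ?_⟩
  rw [h] at key
  simpa [BestChoice.AsymptoticallyOptimal] using key
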